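/- Let $n\ge 1$ and $\tau,\alpha>0$. A partition is $\lambda\in\mathbb Z^n$ with $\lambda_1\ge\cdots\ge\lambda_n\ge 0$; put $|\lambda|=\sum_i\lambda_i$ and let $a_\lambda(s)$, $l_\lambda(s)$, $a'(s)=j-1$, $l'(s)=i-1$ be the arm, leg, coarm and coleg of a box $s=(i,j)$ of its diagram. The Okounkov polynomial is $$P_\lambda(x;\tau,\alpha)=\sum_T\psi_T\prod_{s\in\lambda}\Big[x_{T(s)}^2-\big(a'(s)+\tau(n-T(s)-l'(s))+\alpha\big)^2\Big],$$ where $T$ runs over the reverse tableaux of shape $\lambda$ with entries in $\{1,\dots,n\}$ (strictly decreasing down columns, weakly decreasing along rows). Here $\psi_T=\prod_{i=1}^n\psi_{\lambda^{(i-1)}\setminus\lambda^{(i)}}$ with $\lambda^{(i)}=\{s : T(s)>i\}$; $\psi_{\lambda\setminus\mu}=\prod_s b_\mu(s)/b_\lambda(s)$ over the boxes $s\in\mu$ with $a_\lambda(s)>a_\mu(s)$ and $l_\lambda(s)=l_\mu(s)$; and $b_\lambda(s)=\frac{\tau l_\lambda(s)+a_\lambda(s)+\tau}{\tau l_\lambda(s)+a_\lambda(s)+1}$.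 Put $q_\lambda=(-1)^{|\lambda|}P_\lambda$. Let $m\ge 0$ be an integer and take $n=2$, $\tau=1$, $\alpha=\frac{m+1}2$ (the parameters of the group $U(m+2,2)$); put $\rho_1=\alpha+1$, $\rho_2=\alpha$. Let $\mathcal C=\{x\in\mathbb R^2: x_1\ge x_2\ge 0\}$, $$\mathcal A_0=\{x\in\mathcal C: q_\lambda(x;1,\alpha)\ge 0\text{ for all partitions }\lambda=(\lambda_1,\lambda_2)\},$$ $$T_1=[0,\alpha]^2\cap\mathcal C,\qquad T_2=[\alpha,\alpha+1]^2\cap\mathcal C,\qquad T_2'=\{x: x_1\ge x_2\ge\rho_2,\ x_1+x_2\le\rho_1+\rho_2\}.$$ Let $s(t)=\dfrac{\sin \pi t}{(t+1)(t+2)\cdots(t+m)}$ (so $s(t)=\sin\pi t$ if $m=0$), let $S(t,u)=\dfrac{s(t)-s(u)}{t-u}$ for $t\ne u$ and $S(t,t)=s'(t)$, and let $$W=\{x\in T_2: S(x_1-\alpha,x_2-\alpha)\ge 0\}.$$ Then $$\mathcal A_0=T_1\cup W.$$ Moreover, the set $W$ is also described by $$W=\{x\in T_2': S(x_1-\alpha,x_2-\alpha)\ge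 0\}=\{x\in T_2': R(x)\ge 0\},\qquad R(x)=\sum_{k=0}^\infty\frac{(\rho_2+x_2)_k(\rho_2-x_2)_k}{(\rho_1+x_1)_k(\rho_1-x_1)_k},$$ where $(a)_k=a(a+1)\cdots(a+k-1)$ and the series converges at every point of $T_2'$ (at the single point $(\rho_1,\rho_2)$ the terms with $k\ge 1$ have the form $0/0$ and are read as $0$). -/

import Mathlib

namespace Okounkov

/-! ### Okounkov polynomials through reverse tableaux

Rows are indexed by `Fin n` and columns by natural numbers, both starting at `0`. A partition with at
most `n` parts is an antitone `l : Fin n → ℕ`, and the box `(i, j)` lies in its diagram when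
`j < l i`. With indices from `0`, the coarm of `(i, j)` is `j` and its coleg is `i`. -/

/-- The arm of the box `(i, j)`, to be used for boxes of the diagram of `l`. -/
def arm {n : ℕ} (l : Fin n → ℕ) (i : Fin n) (j : ℕ) : ℕ := l i - (j + 1)

/-- The leg of the box `(i, j)`: the number of boxes below it in the same column. -/
def leg {n : ℕ} (l : Fin n → ℕ) (i : Fin n) (j : ℕ) : ℕ :=
  (Finset.univ.filter fun k : Fin n => i < k ∧ j < l k).card

/-- The boxes of the diagram of `l`. -/
abbrev Box {n : ℕ} (l : Fin n → ℕ) : Type := Σ i : Fin n, Fin (l i)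

/-- `b_l(s) = (τ · leg + arm + τ) / (τ · leg + arm + 1)`. -/
noncomputable def b {n : ℕ} (τ : ℝ) (l : Fin n → ℕ) (i : Fin n) (j : ℕ) : ℝ :=
  (τ * leg l i j + arm l i j + τ) / (τ * leg l i j + arm l i j + 1)

/-- For diagrams `m ⊆ l`, the product of `b_m(s) / b_l(s)` over the boxes `s` of `m` whose arm is
larger in `l` than in `m` and whose leg is the same in both. -/
noncomputable def psi {n : ℕ} (τ : ℝ) (l m : Fin n → ℕ) : ℝ :=
  ∏ s ∈ (Finset.univ : Finset (Box m)).filter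
      (fun s => arm m s.1 s.2 < arm l s.1 s.2 ∧ leg l s.1 s.2 = leg m s.1 s.2),
    b τ m s.1 s.2 / b τ l s.1 s.2

/-- Reverse tableaux with entries in `Fin n`: strictly decreasing down the columns and weakly
decreasing along the rows. The entry `t : Fin n` stands for the number `t + 1` of `{1, …, n}`. -/
def IsReverseTableau {n : ℕ} (l : Fin n → ℕ) (T : Box l → Fin n) : Prop :=
  (∀ s s' : Box l, s.1 = s'.1 → (s.2 : ℕ) ≤ s'.2 → T s' ≤ T s) ∧
  (∀ s s' : Box l, (s.2 : ℕ) = s'.2 → s.1 < s'.1 → T s' < T s)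

/-- The row lengths of the diagram `{s | T(s) > k}`, for entries numbered from `1`
(that is, `k ≤ T s` for entries numbered from `0`). -/
def level {n : ℕ} (l : Fin n → ℕ) (T : Box l → Fin n) (k : ℕ) : Fin n → ℕ :=
  fun i => (Finset.univ.filter fun j : Fin (l i) => k ≤ (T ⟨i, j⟩ : ℕ)).card

/-- The weight `ψ_T` of a reverse tableau. -/
noncomputable def psiTableau {n : ℕ} (τ : ℝ) (l : Fin n → ℕ) (T : Box l → Fin n) : ℝ :=
  ∏ k : Fin n, psi τ (level l T k) (level l T (k + 1))

open Classical in
/-- The Okounkov (BC type interpolation) polynomial `P_l(x; τ, α)` in `n` variables: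
the sum over reverse tableaux `T` of shape `l` of
`ψ_T ∏_s [x_{T(s)}² - (a'(s) + τ (n - T(s) - l'(s)) + α)²]`, entries of `T` numbered from `1`. -/
noncomputable def P {n : ℕ} (τ α : ℝ) (l : Fin n → ℕ) (x : Fin n → ℝ) : ℝ :=
  ∑ T ∈ (Finset.univ : Finset (Box l → Fin n)).filter (IsReverseTableau l),
    psiTableau τ l T *
      ∏ s : Box l, (x (T s) ^ 2 -
        (((s.2 : ℕ) : ℝ) + τ * ((n : ℝ) - (((T s : ℕ) : ℝ) + 1) - ((s.1 : ℕ) : ℝ)) + α) ^ 2)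

/-- The signed polynomial `q_l = (-1)^{|l|} P_l`. -/
noncomputable def q {n : ℕ} (τ α : ℝ) (l : Fin n → ℕ) (x : Fin n → ℝ) : ℝ :=
  (-1) ^ (∑ i, l i) * P τ α l x

/-- The chamber `x_1 ≥ ⋯ ≥ x_n ≥ 0`. -/
def chamber (n : ℕ) : Set (Fin n → ℝ) := {x | Antitone x ∧ ∀ i, 0 ≤ x i}

/-- The points of the chamber at which every `q_l` is nonnegative. -/
def A₀ (n : ℕ) (τ α : ℝ) : Set (Fin n → ℝ) :=
  {x | x ∈ chamber n ∧ ∀ l : Fin n → ℕ, Antitone l → 0 ≤ q τ α l x}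

/-- `ρ_i = τ (n - i) + α`, for `i` numbered from `1`. -/
def rho (n : ℕ) (τ α : ℝ) (i : Fin n) : ℝ := τ * ((n : ℝ) - (((i : ℕ) : ℝ) + 1)) + α

/-! ### The regions in rank two -/

/-- The triangle `[0, α]² ∩ C`. -/
def T₁ (α : ℝ) : Set (Fin 2 → ℝ) := {x | x ∈ chamber 2 ∧ ∀ i, x i ∈ Set.Icc 0 α}

/-- The triangle `[α, α + 1]² ∩ C`. -/
def T₂ (α : ℝ) : Set (Fin 2 → ℝ) := {x | x ∈ chamber 2 ∧ ∀ i, x i ∈ Set.Icc α (α + 1)}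

/-- The smaller triangle `x_1 ≥ x_2 ≥ ρ_2`, `x_1 + x_2 ≤ ρ_1 + ρ_2`. -/
def T₂' (α : ℝ) : Set (Fin 2 → ℝ) :=
  {x | x 1 ≤ x 0 ∧ rho 2 1 α 1 ≤ x 1 ∧ x 0 + x 1 ≤ rho 2 1 α 0 + rho 2 1 α 1}

/-- `s(t) = sin(πt) / ((t + 1) ⋯ (t + m))`. -/
noncomputable def s (m : ℕ) (t : ℝ) : ℝ :=
  Real.sin (Real.pi * t) / ∏ i ∈ Finset.range m, (t + ((i : ℝ) + 1))

open Classical in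
/-- The symmetric divided difference of `s`. -/
noncomputable def S (m : ℕ) (t u : ℝ) : ℝ :=
  if t = u then deriv (s m) t else (s m t - s m u) / (t - u)

/-- The points of `T₂` with `S(x_1 - α, x_2 - α) ≥ 0`, where `α = (m + 1) / 2`. -/
def W (m : ℕ) : Set (Fin 2 → ℝ) :=
  {x | x ∈ T₂ (((m : ℝ) + 1) / 2) ∧
    0 ≤ S m (x 0 - ((m : ℝ) + 1) / 2) (x 1 - ((m : ℝ) + 1) / 2)}

/-- The `k`-th term `(ρ_2 + x_2)_k (ρ_2 - x_2)_k / ((ρ_1 + x_1)_k (ρ_1 - x_1)_k)`. At the single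
point `(ρ_1, ρ_2)` of `T₂'` the terms with `k ≥ 1` have the form `0 / 0` and count as `0`. -/
noncomputable def RTerm (α : ℝ) (x : Fin 2 → ℝ) (k : ℕ) : ℝ :=
  ((ascPochhammer ℝ k).eval (rho 2 1 α 1 + x 1) * (ascPochhammer ℝ k).eval (rho 2 1 α 1 - x 1)) /
  ((ascPochhammer ℝ k).eval (rho 2 1 α 0 + x 0) * (ascPochhammer ℝ k).eval (rho 2 1 α 0 - x 0))

/-- The hypergeometric sum `R(x) = ∑_k RTerm x k`. -/
noncomputable def R (α : ℝ) (x : Fin 2 → ℝ) : ℝ := ∑' k : ℕ, RTerm α x k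

end Okounkov

namespace Okounkov

/-! At `τ = 1` every weight is `1`, and a two-row reverse tableau is determined by the number `c` of
entries 2 in its first row, so `q` is an explicit sum over `c` (`q_rank_two`).

Write `x = (α + t, α + u)`. On `T₂`, for shapes with two nonempty rows every summand is nonnegative
by signs (`q_nonneg_of_two_rows`). For one row of length `k` and `t < 1`, `q` is a positive factor
times the partial sum up to `c = k` of the series `R` (`q_one_row`). All terms after the first are
nonpositive, so the partial sums decrease, and all of them are nonnegative exactly when `R ≥ 0`.

The partial sums telescope after multiplication by `x 0 ^ 2 - x 1 ^ 2` (`sum_sqProd_div`). Since `2α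
= m + 1` is an integer, Euler's sine product gives the limit, and `R` becomes `S` up to a positive
factor (`tsum_ratio`). The shapes (1,1) and (1,0) exclude the points outside `T₁` and `T₂`;
`add_le_one_of_S_nonneg` shrinks `T₂` to `T₂'`. The corner `t = 1`, `u = 0`, where denominators
vanish, is treated by hand. -/

/-! ### Two-row reverse tableaux at `τ = 1`. -/

theorem b_one {n : ℕ} (l : Fin n → ℕ) (i : Fin n) (j : ℕ) : b 1 l i j = 1 := by
  unfold b
  exact div_self (by positivity)

theorem psiTableau_one {n : ℕ} (l : Fin n → ℕ) (T : Box l → Fin n) : psiTableau 1 l T = 1 := by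
  simp [psiTableau, psi, b_one]

/-- The reverse tableau with two rows whose first row starts with `c` entries `2`. -/
def rowTableau (l : Fin 2 → ℕ) (c : ℕ) (s : Box l) : Fin 2 :=
  if s.1 = 0 ∧ (s.2 : ℕ) < c then 1 else 0

theorem isReverseTableau_rowTableau (l : Fin 2 → ℕ) {c : ℕ} (hc : l 1 ≤ c) :
    IsReverseTableau l (rowTableau l c) := by
  constructor
  · rintro ⟨i, j⟩ ⟨i', j'⟩ (h : i = i') (hj : (j : ℕ) ≤ j')
    subst h
    simp only [rowTableau]
    split_ifs with h1 h2 h2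
    · exact le_rfl
    · exact absurd ⟨h1.1, lt_of_le_of_lt hj h1.2⟩ h2
    · exact Fin.zero_le _
    · exact le_rfl
  · rintro ⟨i, j⟩ ⟨i', j'⟩ (hj : (j : ℕ) = j') (h : i < i')
    have hi : i = 0 := by omega
    have hi' : i' = 1 := by omega
    subst hi hi'
    have := j'.2
    have h1 : (j : ℕ) < c := by omega
    simp [rowTableau, h1]

theorem exists_threshold {N : ℕ} (p : Fin N → Prop) (hp : ∀ i j : Fin N, i ≤ j → p j → p i) :
    ∃ c ≤ N, ∀ i : Fin N, p i ↔ (i : ℕ) < c := by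
  classical
  by_cases h : ∀ i, p i
  · exact ⟨N, le_rfl, fun i => ⟨fun _ => i.2, fun _ => h i⟩⟩
  · push Not at h
    obtain ⟨i₀, hi₀⟩ := h
    have hex : ∃ n, ∃ h : n < N, ¬ p ⟨n, h⟩ := ⟨i₀, i₀.2, hi₀⟩
    obtain ⟨hN, hn⟩ := Nat.find_spec hex
    refine ⟨Nat.find hex, hN.le, fun i => ⟨fun hi => ?_, fun hi => ?_⟩⟩
    · by_contra hlt
      exact hn (hp _ i (Fin.le_def.2 (not_lt.1 hlt)) hi)
    · by_contra hpi
      exact Nat.find_min hex hi ⟨i.2, hpi⟩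

/-- With two available entries, a column of height two must be 2 over 1. So the second row is
constant, and the entries 2 of the first row form an initial segment covering at least the first `l
1` columns. -/
theorem exists_eq_rowTableau (l : Fin 2 → ℕ) (hl : Antitone l) {T : Box l → Fin 2}
    (hT : IsReverseTableau l T) : ∃ c ∈ Finset.Icc (l 1) (l 0), rowTableau l c = T := by
  obtain ⟨c, hc, h⟩ := exists_threshold (fun j : Fin (l 0) => T ⟨0, j⟩ = 1) (by
    intro i j hij hj
    have := hT.1 ⟨0, i⟩ ⟨0, j⟩ rfl hij
    rw [hj] at this
    omega)
  have h10 : l 1 ≤ l 0 := hl (by decide)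
  have hlt : ∀ j : Fin (l 1), T ⟨1, j⟩ < T ⟨0, ⟨j, j.2.trans_le h10⟩⟩ := fun j =>
    hT.2 ⟨0, ⟨j, j.2.trans_le h10⟩⟩ ⟨1, j⟩ rfl (by decide : (0 : Fin 2) < 1)
  refine ⟨c, Finset.mem_Icc.2 ⟨?_, hc⟩, ?_⟩
  · by_contra hlc
    have h1 := hlt ⟨c, not_le.1 hlc⟩
    have h2 := (h ⟨c, (not_le.1 hlc).trans_le h10⟩).1 (by
      simp only at h1
      omega)
    exact lt_irrefl _ h2
  · funext ⟨i, j⟩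
    match i, j with
    | 0, j =>
      by_cases hj : (j : ℕ) < c
      · simp [rowTableau, hj, (h j).2 hj]
      · have := mt (h j).1 hj
        simp only [rowTableau, hj, and_false, if_false]
        omega
    | 1, j =>
      have := hlt j
      simp only [rowTableau, one_ne_zero, false_and, if_false]
      omega

/-- In rank two and at `τ = 1`, the sum over reverse tableaux is a sum over the number of
entries `2` in the first row. -/
theorem q_rank_two (α : ℝ) (l : Fin 2 → ℕ) (hl : Antitone l) (x : Fin 2 → ℝ) :
    q 1 α l x = ∑ c ∈ Finset.Icc (l 1) (l 0),
      (∏ j ∈ Finset.range (l 1), ((α + j) ^ 2 - x 0 ^ 2)) *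
      ((∏ j ∈ Finset.range c, ((α + j) ^ 2 - x 1 ^ 2)) *
        ∏ j ∈ Finset.Ico c (l 0), ((α + 1 + j) ^ 2 - x 0 ^ 2)) := by
  classical
  unfold q P
  rw [Finset.mul_sum]
  symm
  refine Finset.sum_bij (fun c _ => rowTableau l c) ?_ ?_ ?_ ?_
  · intro c hc
    exact Finset.mem_filter.2 ⟨Finset.mem_univ _,
      isReverseTableau_rowTableau l (Finset.mem_Icc.1 hc).1⟩
  · intro c hc d hd hcd
    simp only [Finset.mem_Icc] at hc hd
    by_contra hne
    wlog hlt : c < d generalizing c d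
    · exact this d c hcd.symm hd hc (Ne.symm hne) (by omega)
    have := congrFun hcd ⟨0, ⟨c, by omega⟩⟩
    simp [rowTableau, hlt] at this
  · intro T hT
    obtain ⟨c, hc, h⟩ := exists_eq_rowTableau l hl (Finset.mem_filter.1 hT).2
    exact ⟨c, hc, h⟩
  · intro c hc
    simp only [Finset.mem_Icc] at hc
    rw [psiTableau_one, one_mul]
    have hsign : (-1 : ℝ) ^ (∑ i, l i) = ∏ s : Box l, (-1 : ℝ) := by
      simp [Finset.prod_const, Fintype.card_sigma]
    -- One sign per box turns each factor into shift squared minus variable squared.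
    rw [hsign, ← Finset.prod_mul_distrib, Fintype.prod_sigma, Fin.prod_univ_two, mul_comm]
    congr 1
    · have h1 : ∏ j ∈ Finset.range c, ((α + j) ^ 2 - x 1 ^ 2) = ∏ j ∈ Finset.range c,
          if j < c then (α + j) ^ 2 - x 1 ^ 2 else (α + 1 + j) ^ 2 - x 0 ^ 2 :=
        Finset.prod_congr rfl fun j hj => by rw [if_pos (Finset.mem_range.1 hj)]
      have h2 : ∏ j ∈ Finset.Ico c (l 0), ((α + 1 + j) ^ 2 - x 0 ^ 2) =
          ∏ j ∈ Finset.Ico c (l 0),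
          if j < c then (α + j) ^ 2 - x 1 ^ 2 else (α + 1 + j) ^ 2 - x 0 ^ 2 :=
        Finset.prod_congr rfl fun j hj => by
          rw [if_neg (not_lt.2 (Finset.mem_Ico.1 hj).1)]
      rw [h1, h2, Finset.prod_range_mul_prod_Ico _ hc.2, Finset.prod_range]
      refine Finset.prod_congr rfl fun j _ => ?_
      by_cases hj : (j : ℕ) < c
      · simp [rowTableau, hj]
        ring
      · simp [rowTableau, hj]
        ring
    · rw [Finset.prod_range]
      refine Finset.prod_congr rfl fun j _ => ?_
      simp [rowTableau]
      ring
-- Telescoping of the partial sums.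
open Filter Topology Finset

/-- `∏_{j < k} ((a + j)² - x²)`. -/
noncomputable def sqProd (a x : ℝ) (k : ℕ) : ℝ := ∏ j ∈ range k, ((a + j) ^ 2 - x ^ 2)

theorem sqProd_zero (a x : ℝ) : sqProd a x 0 = 1 := by simp [sqProd]

theorem sqProd_succ (a x : ℝ) (k : ℕ) :
    sqProd a x (k + 1) = sqProd a x k * ((a + k) ^ 2 - x ^ 2) := prod_range_succ _ _

theorem sqProd_succ' (a x : ℝ) (k : ℕ) :
    sqProd a x (k + 1) = (a ^ 2 - x ^ 2) * sqProd (a + 1) x k := by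
  rw [sqProd, prod_range_succ', mul_comm]
  congr 1
  · simp
  · refine prod_congr rfl fun j _ => ?_
    push_cast
    ring

theorem sqProd_pos {a x : ℝ} (hx : 0 ≤ x) (h : x < a) (k : ℕ) : 0 < sqProd a x k := by
  refine prod_pos fun j _ => ?_
  have : (0 : ℝ) ≤ j := j.cast_nonneg
  nlinarith

theorem sqProd_nonneg {a x : ℝ} (hx : 0 ≤ x) (h : x ≤ a) (k : ℕ) : 0 ≤ sqProd a x k := by
  refine prod_nonneg fun j _ => ?_
  have : (0 : ℝ) ≤ j := j.cast_nonneg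
  nlinarith

theorem ascPochhammer_mul_eq_sqProd (a x : ℝ) (k : ℕ) :
    (ascPochhammer ℝ k).eval (a + x) * (ascPochhammer ℝ k).eval (a - x) = sqProd a x k := by
  induction k with
  | zero => simp [sqProd]
  | succ k ih =>
    rw [ascPochhammer_succ_eval, ascPochhammer_succ_eval, sqProd_succ, ← ih]
    ring

theorem RTerm_eq (α : ℝ) (x : Fin 2 → ℝ) (k : ℕ) :
    RTerm α x k = sqProd α (x 1) k / sqProd (α + 1) (x 0) k := by
  have h0 : rho 2 1 α 0 = α + 1 := by simp [rho]; ring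
  have h1 : rho 2 1 α 1 = α := by simp [rho]; ring
  rw [RTerm, h0, h1, ascPochhammer_mul_eq_sqProd, ascPochhammer_mul_eq_sqProd]

/-- Telescoping: `x² - y² = ((a + k)² - y²) - ((a + k)² - x²)`, where the first factor extends the
numerator of the `k`-th term and the second cancels the last factor of its denominator. -/
theorem sum_sqProd_div {a x y : ℝ} (h : ∀ k, sqProd (a + 1) x k ≠ 0) (k : ℕ) :
    (∑ c ∈ range (k + 1), sqProd a y c / sqProd (a + 1) x c) * (x ^ 2 - y ^ 2) =
      (a ^ 2 - y ^ 2) * sqProd (a + 1) y k / sqProd (a + 1) x k + (x ^ 2 - a ^ 2) := by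
  rw [← sqProd_succ']
  induction k with
  | zero => simp [sqProd]
  | succ k ih =>
    have h1 := h k
    have h2 := h (k + 1)
    rw [sum_range_succ, add_mul, ih, sqProd_succ a y (k + 1), sqProd_succ (a + 1) x k]
    rw [sqProd_succ] at h2
    have h3 := right_ne_zero_of_mul h2
    field_simp
    push_cast
    ring

/-! ### Asymptotics through Euler's sine product. -/

/-- The factor `(t + 1) ⋯ (t + k)`. -/
noncomputable def shiftProd (k : ℕ) (t : ℝ) : ℝ := ∏ i ∈ range k, (t + ((i : ℝ) + 1))

theorem s_eq (m : ℕ) (t : ℝ) : s m t = Real.sin (Real.pi * t) / shiftProd m t := rfl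

theorem shiftProd_succ (k : ℕ) (t : ℝ) :
    shiftProd (k + 1) t = shiftProd k t * (t + (k + 1)) := prod_range_succ _ _

theorem shiftProd_pos {t : ℝ} (ht : 0 ≤ t) (k : ℕ) : 0 < shiftProd k t :=
  prod_pos fun _ _ => by positivity

theorem tendsto_euler_sinc (t : ℝ) :
    Tendsto (fun k : ℕ => ∏ j ∈ range k, (1 - t ^ 2 / ((j : ℝ) + 1) ^ 2)) atTop
      (𝓝 (Real.sinc (Real.pi * t))) := by
  rcases eq_or_ne t 0 with rfl | ht
  · simp
  · have h : Real.pi * t ≠ 0 := mul_ne_zero Real.pi_ne_zero ht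
    rw [Real.sinc_of_ne_zero h]
    refine ((Real.tendsto_euler_sin_prod t).div_const (Real.pi * t)).congr fun k => ?_
    exact mul_div_cancel_left₀ _ h

/-- The normalized limit of `sqProd (α + 1) (α + t) k` for `α = (m + 1) / 2`. -/
noncomputable def sqProdLim (m : ℕ) (t : ℝ) : ℝ :=
  Real.sinc (Real.pi * t) / shiftProd (m + 1) t

/-- The factors on the left are `(j + 1 - t)(j + m + 2 + t)`. Multiplying by `(t + 1) ⋯ (t + m + 1)`
fills the gap at the start of the second progression, which is then cut after `k` factors instead.
-/
theorem sqProd_mul_shiftProd (m : ℕ) (t : ℝ) (k : ℕ) :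
    sqProd (((m : ℝ) + 1) / 2 + 1) (((m : ℝ) + 1) / 2 + t) k * shiftProd (m + 1) t =
      (∏ j ∈ range k, (((j : ℝ) + 1) ^ 2 - t ^ 2)) *
        ∏ i ∈ range (m + 1), (t + k + ((i : ℝ) + 1)) := by
  induction k with
  | zero => simp [sqProd, shiftProd]
  | succ k ih =>
    have h : (∏ i ∈ range (m + 1), (t + k + ((i : ℝ) + 1))) * (t + k + m + 2) =
        (t + k + 1) * ∏ i ∈ range (m + 1), (t + (k + 1 : ℕ) + ((i : ℝ) + 1)) := by
      have h1 := prod_range_succ (fun i : ℕ => t + k + ((i : ℝ) + 1)) (m + 1)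
      have h2 := prod_range_succ' (fun i : ℕ => t + k + ((i : ℝ) + 1)) (m + 1)
      rw [h1] at h2
      push_cast at h2 ⊢
      rw [mul_comm (t + k + 1)]
      convert h2 using 2 <;> ring_nf
    rw [sqProd_succ, prod_range_succ, mul_right_comm, ih]
    linear_combination (k + 1 - t) * (∏ j ∈ range k, (((j : ℝ) + 1) ^ 2 - t ^ 2)) * h

/-- The normalization does not depend on `t`, so it cancels in the quotients of the series. -/
theorem tendsto_sqProd (m : ℕ) {t : ℝ} (ht : 0 ≤ t) :
    Tendsto (fun k : ℕ => sqProd (((m : ℝ) + 1) / 2 + 1) (((m : ℝ) + 1) / 2 + t) k /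
      ((∏ j ∈ range k, ((j : ℝ) + 1) ^ 2) * ((k : ℝ) + 1) ^ (m + 1))) atTop
      (𝓝 (sqProdLim m t)) := by
  have h1 : Tendsto (fun k : ℕ => ∏ i ∈ range (m + 1), ((t + k + ((i : ℝ) + 1)) / ((k : ℝ) + 1)))
      atTop (𝓝 (∏ i ∈ range (m + 1), (1 : ℝ))) := by
    refine tendsto_finsetProd _ fun i _ => ?_
    have h2 : Tendsto (fun k : ℕ => (t + i) * (1 / ((k : ℝ) + 1)) + 1) atTop (𝓝 ((t + i) * 0 + 1)) :=
      (tendsto_one_div_add_atTop_nhds_zero_nat.const_mul _).add_const _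
    rw [mul_zero, zero_add] at h2
    refine h2.congr fun k => ?_
    have : (k : ℝ) + 1 ≠ 0 := by positivity
    field_simp
    ring
  rw [prod_const_one] at h1
  have h3 := ((tendsto_euler_sinc t).mul h1).div_const (shiftProd (m + 1) t)
  rw [mul_one] at h3
  refine h3.congr fun k => ?_
  have hp := (shiftProd_pos ht (m + 1)).ne'
  rw [div_eq_iff hp, div_mul_eq_mul_div, sqProd_mul_shiftProd, prod_div_distrib, prod_const,
    card_range, mul_div_mul_comm, ← prod_div_distrib]
  congr 1
  refine prod_congr rfl fun j _ => ?_
  have : (j : ℝ) + 1 ≠ 0 := by positivity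
  field_simp

theorem sqProdLim_pos (m : ℕ) {t : ℝ} (ht : 0 ≤ t) (ht1 : t < 1) : 0 < sqProdLim m t := by
  refine div_pos ?_ (shiftProd_pos ht _)
  rcases ht.eq_or_lt with rfl | h
  · simp
  · have := Real.pi_pos
    rw [Real.sinc_of_ne_zero (by positivity)]
    exact div_pos (Real.sin_pos_of_pos_of_lt_pi (by positivity) (by nlinarith)) (by positivity)

theorem mul_sqProdLim (m : ℕ) {t : ℝ} (ht : 0 ≤ t) :
    t * (m + 1 + t) * sqProdLim m t * Real.pi = s m t := by
  rw [sqProdLim, s_eq, shiftProd_succ]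
  have h1 := (shiftProd_pos ht m).ne'
  have h2 : t + (m + 1) ≠ 0 := by positivity
  rcases ht.eq_or_lt with rfl | h
  · simp
  · have := Real.pi_pos
    rw [Real.sinc_of_ne_zero (by positivity)]
    field_simp
    ring

/-! ### Sign, majorant and convergence of the series. -/

/-- Only the first factor of the numerator can be negative. Successive quotients are at most `(m + 2
+ c) / (m + 4 + c)`, whose product telescopes to quadratic decay; the constant comes from `u * (m +
1 + u) ≤ m + 2` in the first term. -/
theorem ratio_bound (m : ℕ) {t u : ℝ} (ht : 0 ≤ t) (ht1 : t < 1) (hu : 0 ≤ u) (hu1 : u ≤ 1) (c : ℕ) :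
    sqProd (((m : ℝ) + 1) / 2) (((m : ℝ) + 1) / 2 + u) (c + 1) /
        sqProd (((m : ℝ) + 1) / 2 + 1) (((m : ℝ) + 1) / 2 + t) (c + 1) ≤ 0 ∧
    -(sqProd (((m : ℝ) + 1) / 2) (((m : ℝ) + 1) / 2 + u) (c + 1) /
        sqProd (((m : ℝ) + 1) / 2 + 1) (((m : ℝ) + 1) / 2 + t) (c + 1)) ≤
      ((m + 2) * ((m + 2) * (m + 3)) / ((1 - t) * (m + 2 + t))) / ((m + 2 + c) * (m + 3 + c)) := by
  have hm : (0 : ℝ) ≤ m := m.cast_nonneg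
  induction c with
  | zero =>
    have h1 : 0 < (1 - t) * (m + 2 + t) := mul_pos (by linarith) (by linarith)
    have h2 : (((m : ℝ) + 1) / 2 + 1) ^ 2 - (((m : ℝ) + 1) / 2 + t) ^ 2 = (1 - t) * (m + 2 + t) := by
      ring
    have h3 : (((m : ℝ) + 1) / 2) ^ 2 - (((m : ℝ) + 1) / 2 + u) ^ 2 = -(u * (m + 1 + u)) := by ring
    simp only [sqProd_succ, sqProd_zero, Nat.cast_zero, add_zero, one_mul, h2, h3, neg_div, neg_neg]
    refine ⟨neg_nonpos.2 (by positivity), ?_⟩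
    rw [div_right_comm, mul_div_cancel_right₀ _ (by positivity)]
    refine div_le_div_of_nonneg_right ?_ h1.le
    nlinarith
  | succ c ih =>
    have hc : (0 : ℝ) ≤ c := c.cast_nonneg
    have hd : 0 < ((m : ℝ) + 1) / 2 + 1 + (c + 1 : ℕ) - (((m : ℝ) + 1) / 2 + t) := by
      push_cast; linarith
    have hD : 0 < (((m : ℝ) + 1) / 2 + 1 + (c + 1 : ℕ)) ^ 2 - (((m : ℝ) + 1) / 2 + t) ^ 2 := by
      push_cast at hd ⊢; nlinarith
    have hr0 : 0 ≤ ((((m : ℝ) + 1) / 2 + (c + 1 : ℕ)) ^ 2 - (((m : ℝ) + 1) / 2 + u) ^ 2) /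
        ((((m : ℝ) + 1) / 2 + 1 + (c + 1 : ℕ)) ^ 2 - (((m : ℝ) + 1) / 2 + t) ^ 2) := by
      refine div_nonneg ?_ hD.le
      push_cast; nlinarith
    have hr1 : ((((m : ℝ) + 1) / 2 + (c + 1 : ℕ)) ^ 2 - (((m : ℝ) + 1) / 2 + u) ^ 2) /
        ((((m : ℝ) + 1) / 2 + 1 + (c + 1 : ℕ)) ^ 2 - (((m : ℝ) + 1) / 2 + t) ^ 2) ≤
        (m + 2 + c) / (m + 4 + c) := by
      rw [div_le_div_iff₀ hD (by positivity)]
      have e1 : (((m : ℝ) + 1) / 2 + (c + 1 : ℕ)) ^ 2 - (((m : ℝ) + 1) / 2 + u) ^ 2 ≤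
          (c + 1) * (m + 2 + c) := by push_cast; nlinarith
      have e2 : (c + 1) * (m + 4 + c) ≤
          (((m : ℝ) + 1) / 2 + 1 + (c + 1 : ℕ)) ^ 2 - (((m : ℝ) + 1) / 2 + t) ^ 2 := by
        push_cast; nlinarith
      refine (mul_le_mul_of_nonneg_right e1 (by positivity)).trans ?_
      refine le_of_eq_of_le (by ring) (mul_le_mul_of_nonneg_left e2 (by positivity))
    rw [sqProd_succ _ _ (c + 1), sqProd_succ _ _ (c + 1), mul_div_mul_comm]
    refine ⟨mul_nonpos_of_nonpos_of_nonneg ih.1 hr0, ?_⟩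
    rw [← neg_mul]
    refine (mul_le_mul ih.2 hr1 hr0 ?_).trans_eq ?_
    · have : 0 < 1 - t := by linarith
      positivity
    · push_cast
      have : 1 - t ≠ 0 := by linarith
      have : m + 2 + t ≠ 0 := by positivity
      field_simp
      ring

/-- The terms of the hypergeometric series at `x = (α + t, α + u)`, for `α = (m + 1) / 2`. -/
noncomputable def ratio (m : ℕ) (t u : ℝ) (c : ℕ) : ℝ :=
  sqProd (((m : ℝ) + 1) / 2) (((m : ℝ) + 1) / 2 + u) c /
    sqProd (((m : ℝ) + 1) / 2 + 1) (((m : ℝ) + 1) / 2 + t) c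

theorem RTerm_eq_ratio (m : ℕ) (x : Fin 2 → ℝ) :
    RTerm (((m : ℝ) + 1) / 2) x =
      ratio m (x 0 - ((m : ℝ) + 1) / 2) (x 1 - ((m : ℝ) + 1) / 2) := by
  funext c
  rw [RTerm_eq, ratio, add_sub_cancel, add_sub_cancel]

/-- A summable majorant of `ratio m t u`, uniform in `u`. -/
noncomputable def ratioBound (m : ℕ) (t : ℝ) (c : ℕ) : ℝ :=
  if c = 0 then 1 else
    (((m : ℝ) + 2) * ((m + 2) * (m + 3)) / ((1 - t) * (m + 2 + t))) / ((m + 1 + c) * (m + 2 + c))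

theorem summable_ratioBound (m : ℕ) {t : ℝ} (ht : 0 ≤ t) (ht1 : t < 1) :
    Summable (ratioBound m t) := by
  have h : 0 < 1 - t := by linarith
  rw [← summable_nat_add_iff 1]
  set B := (((m : ℝ) + 2) * ((m + 2) * (m + 3)) / ((1 - t) * (m + 2 + t))) with hB
  have hB0 : 0 ≤ B := by positivity
  have hs : Summable fun c : ℕ => B * (1 / ((c + 1 : ℕ) : ℝ) ^ 2) :=
    ((summable_nat_add_iff 1).2 (Real.summable_one_div_nat_pow.2 one_lt_two)).mul_left B
  refine Summable.of_nonneg_of_le (fun c => ?_) (fun c => ?_) hs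
  · simp only [ratioBound, Nat.succ_ne_zero, if_false]
    positivity
  · simp only [ratioBound, Nat.succ_ne_zero, if_false]
    rw [← hB, mul_one_div]
    refine div_le_div_of_nonneg_left hB0 (by positivity) ?_
    have : (0 : ℝ) ≤ m := m.cast_nonneg
    rw [sq]
    gcongr <;> linarith

theorem ratio_nonpos {m : ℕ} {t u : ℝ} (ht : 0 ≤ t) (ht1 : t < 1) (hu : 0 ≤ u) (hu1 : u ≤ 1)
    (c : ℕ) : ratio m t u (c + 1) ≤ 0 := (ratio_bound m ht ht1 hu hu1 c).1

theorem norm_ratio_le {m : ℕ} {t u : ℝ} (ht : 0 ≤ t) (ht1 : t < 1) (hu : 0 ≤ u) (hu1 : u ≤ 1)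
    (c : ℕ) : ‖ratio m t u c‖ ≤ ratioBound m t c := by
  cases c with
  | zero => simp [ratio, ratioBound, sqProd_zero]
  | succ c =>
    rw [Real.norm_of_nonpos (ratio_nonpos ht ht1 hu hu1 c)]
    refine (ratio_bound m ht ht1 hu hu1 c).2.trans_eq ?_
    simp only [ratioBound, Nat.succ_ne_zero, if_false]
    push_cast
    ring_nf

theorem summable_ratio {m : ℕ} {t u : ℝ} (ht : 0 ≤ t) (ht1 : t < 1) (hu : 0 ≤ u) (hu1 : u ≤ 1) :
    Summable (ratio m t u) :=
  Summable.of_norm_bounded (summable_ratioBound m ht ht1) (norm_ratio_le ht ht1 hu hu1)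

theorem continuousOn_tsum_ratio (m : ℕ) {t : ℝ} (ht : 0 ≤ t) (ht1 : t < 1) :
    ContinuousOn (fun u => ∑' c, ratio m t u c) (Set.Icc 0 1) := by
  refine continuousOn_tsum (fun c => ?_) (summable_ratioBound m ht ht1)
    fun c u hu => norm_ratio_le ht ht1 hu.1 hu.2 c
  unfold ratio sqProd
  fun_prop

/-! ### The sum of the series in terms of `S`. -/

theorem tsum_ratio_of_ne (m : ℕ) {t u : ℝ} (ht : 0 ≤ t) (ht1 : t < 1) (hu : 0 ≤ u) (hu1 : u ≤ 1)
    (htu : t ≠ u) :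
    (∑' c, ratio m t u c) * (sqProdLim m t * (m + 1 + t + u) * Real.pi) = S m t u := by
  have hm : (0 : ℝ) ≤ ((m : ℝ) + 1) / 2 := by positivity
  have hne : ∀ k, sqProd (((m : ℝ) + 1) / 2 + 1) (((m : ℝ) + 1) / 2 + t) k ≠ 0 := fun k =>
    (sqProd_pos (by linarith) (by linarith) k).ne'
  have hL := (sqProdLim_pos m ht ht1).ne'
  have h1 := (((summable_ratio (m := m) ht ht1 hu hu1).hasSum.tendsto_sum_nat.comp
    (tendsto_add_atTop_nat 1)).mul_const
      ((((m : ℝ) + 1) / 2 + t) ^ 2 - (((m : ℝ) + 1) / 2 + u) ^ 2))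
  have h2 := ((((tendsto_sqProd m hu).div (tendsto_sqProd m ht) hL).const_mul
    ((((m : ℝ) + 1) / 2) ^ 2 - (((m : ℝ) + 1) / 2 + u) ^ 2)).add_const
      ((((m : ℝ) + 1) / 2 + t) ^ 2 - (((m : ℝ) + 1) / 2) ^ 2))
  have h3 := tendsto_nhds_unique h1 (h2.congr fun k => by
    have hk : (∏ j ∈ range k, ((j : ℝ) + 1) ^ 2) * ((k : ℝ) + 1) ^ (m + 1) ≠ 0 := by positivity
    simp only [Pi.div_apply, Function.comp_apply, ratio]
    rw [sum_sqProd_div hne, div_div_div_cancel_right₀ hk, mul_div_assoc])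
  have h4 := mul_sqProdLim m ht
  have h5 := mul_sqProdLim m hu
  rw [S, if_neg htu, eq_div_iff (sub_ne_zero.2 htu), ← h4, ← h5]
  have h6 : sqProdLim m u / sqProdLim m t * sqProdLim m t = sqProdLim m u := div_mul_cancel₀ _ hL
  linear_combination sqProdLim m t * Real.pi * h3 - u * (m + 1 + u) * Real.pi * h6

/-- The sign of the derivative is all that is needed later, to sign `s'` on the diagonal. -/
theorem shiftProd_hasDerivAt (m : ℕ) {t : ℝ} (ht : 0 ≤ t) :
    ∃ d, 0 ≤ d ∧ HasDerivAt (shiftProd m) d t := by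
  induction m with
  | zero =>
    refine ⟨0, le_rfl, ?_⟩
    exact (hasDerivAt_const t (1 : ℝ)).congr_of_eventuallyEq
      (Eventually.of_forall fun x => prod_range_zero _)
  | succ m ih =>
    obtain ⟨d, hd, h⟩ := ih
    refine ⟨_, ?_, (h.mul ((hasDerivAt_id t).add_const ((m : ℝ) + 1))).congr_of_eventuallyEq
      (Eventually.of_forall fun x => shiftProd_succ m x)⟩
    have := (shiftProd_pos ht m).le
    simp only [id]
    positivity

theorem s_hasDerivAt (m : ℕ) {t : ℝ} (ht : 0 ≤ t) : ∃ d, 0 ≤ d ∧ HasDerivAt (s m)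
    ((Real.cos (Real.pi * t) * Real.pi * shiftProd m t - Real.sin (Real.pi * t) * d) /
      shiftProd m t ^ 2) t := by
  obtain ⟨d, hd, h⟩ := shiftProd_hasDerivAt m ht
  have h1 : HasDerivAt (fun x => Real.sin (Real.pi * x)) (Real.cos (Real.pi * t) * Real.pi) t := by
    simpa using ((hasDerivAt_id t).const_mul Real.pi).sin
  exact ⟨d, hd, h1.div h (shiftProd_pos ht m).ne'⟩

theorem tsum_ratio (m : ℕ) {t u : ℝ} (ht : 0 ≤ t) (ht1 : t < 1) (hu : 0 ≤ u) (hu1 : u ≤ 1) :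
    (∑' c, ratio m t u c) * (sqProdLim m t * (m + 1 + t + u) * Real.pi) = S m t u := by
  rcases ne_or_eq t u with htu | rfl
  · exact tsum_ratio_of_ne m ht ht1 hu hu1 htu
  -- The diagonal is reached by letting the second argument decrease to `t`: the sum is continuous
  -- by the majorant uniform in `u`, and the divided differences tend to `s'(t)`.
  have : (𝓝[Set.Ioo t 1] t).NeBot := left_nhdsWithin_Ioo_neBot ht1
  have hsub : Set.Ioo t 1 ⊆ Set.Icc 0 1 := fun v hv => ⟨ht.trans hv.1.le, hv.2.le⟩
  have h1 : Tendsto (fun u => (∑' c, ratio m t u c) * (sqProdLim m t * (m + 1 + t + u) * Real.pi))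
      (𝓝[Set.Ioo t 1] t)
      (𝓝 ((∑' c, ratio m t t c) * (sqProdLim m t * (m + 1 + t + t) * Real.pi))) := by
    have h2 := (continuousOn_tsum_ratio m ht ht1 t ⟨hu, hu1⟩).mono_left (nhdsWithin_mono t hsub)
    refine h2.mul (Continuous.tendsto' (by fun_prop) _ _ rfl |>.mono_left nhdsWithin_le_nhds)
  obtain ⟨d, -, hd⟩ := s_hasDerivAt m ht
  have h3 := (hasDerivAt_iff_tendsto_slope.1 hd).mono_left
    (nhdsWithin_mono t fun v (hv : v ∈ Set.Ioo t 1) => hv.1.ne')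
  refine tendsto_nhds_unique h1 ?_
  rw [S, if_pos rfl, hd.deriv]
  refine h3.congr' ?_
  filter_upwards [self_mem_nhdsWithin] with v hv
  rw [tsum_ratio_of_ne m ht ht1 (hsub hv).1 (hsub hv).2 hv.1.ne, S, if_neg hv.1.ne, slope_def_field,
    ← neg_sub (s m t), ← neg_sub t, neg_div_neg_eq]

theorem S_nonneg_iff (m : ℕ) {t u : ℝ} (ht : 0 ≤ t) (ht1 : t < 1) (hu : 0 ≤ u) (hu1 : u ≤ 1) :
    0 ≤ S m t u ↔ 0 ≤ ∑' c, ratio m t u c := by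
  rw [← tsum_ratio m ht ht1 hu hu1]
  have h1 := sqProdLim_pos m ht ht1
  have h2 := Real.pi_pos
  exact mul_nonneg_iff_of_pos_right (by positivity)

/-! ### The regions and the descriptions of `W`. -/

theorem shiftProd_le (m : ℕ) {t u : ℝ} (hu : 0 ≤ u) (h : u ≤ t) : shiftProd m u ≤ shiftProd m t :=
  prod_le_prod (fun _ _ => by positivity) fun _ _ => by linarith

/-- If `t + u > 1` and `u < t`, the midpoint of `πu` and `πt` lies beyond `π/2`, so `sin πt < sin
πu`; the increasing denominator only strengthens this. On the diagonal, `s'` is negative for the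
same reason. -/
theorem add_le_one_of_S_nonneg (m : ℕ) {t u : ℝ} (hu : 0 ≤ u) (hut : u ≤ t) (ht1 : t ≤ 1)
    (h : 0 ≤ S m t u) : t + u ≤ 1 := by
  by_contra! hlt
  have hpi := Real.pi_pos
  have ht : 0 ≤ t := hu.trans hut
  have hsin : 0 ≤ Real.sin (Real.pi * t) :=
    Real.sin_nonneg_of_nonneg_of_le_pi (by positivity) (by nlinarith)
  rcases hut.eq_or_lt with rfl | hut
  · obtain ⟨d, hd, hs⟩ := s_hasDerivAt m ht
    rw [S, if_pos rfl, hs.deriv] at h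
    have hp := shiftProd_pos ht m
    have hcos : Real.cos (Real.pi * u) < 0 :=
      Real.cos_neg_of_pi_div_two_lt_of_lt (by nlinarith) (by nlinarith)
    refine absurd h (not_le.2 (div_neg_of_neg_of_pos ?_ (by positivity)))
    have h1 := mul_neg_of_neg_of_pos (mul_neg_of_neg_of_pos hcos hpi) hp
    have h2 := mul_nonneg hsin hd
    linarith
  · rw [S, if_neg hut.ne'] at h
    refine absurd h (not_le.2 (div_neg_of_neg_of_pos ?_ (by linarith)))
    rw [s_eq, s_eq, sub_neg]
    refine (div_le_div_of_nonneg_left hsin (shiftProd_pos hu m) (shiftProd_le m hu hut.le)).trans_lt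
      (div_lt_div_of_pos_right ?_ (shiftProd_pos hu m))
    rw [← sub_neg, Real.sin_sub_sin]
    have hcos : Real.cos ((Real.pi * t + Real.pi * u) / 2) < 0 :=
      Real.cos_neg_of_pi_div_two_lt_of_lt (by nlinarith) (by nlinarith)
    have hs : 0 < Real.sin ((Real.pi * t - Real.pi * u) / 2) :=
      Real.sin_pos_of_pos_of_lt_pi (by nlinarith) (by nlinarith)
    nlinarith [mul_neg_of_pos_of_neg hs hcos]

theorem mem_T₁_iff {α : ℝ} {x : Fin 2 → ℝ} : x ∈ T₁ α ↔ 0 ≤ x 1 ∧ x 1 ≤ x 0 ∧ x 0 ≤ α := by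
  simp only [T₁, chamber, Set.mem_ofPred_eq, Fin.forall_fin_two, Set.mem_Icc]
  constructor
  · rintro ⟨⟨h, -⟩, h1, h2⟩
    exact ⟨h2.1, h (by decide), h1.2⟩
  · rintro ⟨h1, h2, h3⟩
    refine ⟨⟨?_, by linarith, h1⟩, ⟨by linarith, h3⟩, h1, by linarith⟩
    exact Fin.antitone_iff_succ_le.2 fun i => by fin_cases i; exact h2

theorem mem_chamber_two_iff {x : Fin 2 → ℝ} : x ∈ chamber 2 ↔ 0 ≤ x 1 ∧ x 1 ≤ x 0 := by
  simp only [chamber, Set.mem_ofPred_eq, Fin.forall_fin_two]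
  constructor
  · rintro ⟨h, h1, h2⟩
    exact ⟨h2, h (by decide)⟩
  · rintro ⟨h1, h2⟩
    exact ⟨Fin.antitone_iff_succ_le.2 fun i => by fin_cases i; exact h2, by linarith, h1⟩

theorem mem_T₂_iff {α : ℝ} (hα : 0 ≤ α) {x : Fin 2 → ℝ} :
    x ∈ T₂ α ↔ α ≤ x 1 ∧ x 1 ≤ x 0 ∧ x 0 ≤ α + 1 := by
  simp only [T₂, mem_chamber_two_iff, Set.mem_ofPred_eq, Fin.forall_fin_two, Set.mem_Icc]
  constructor
  · rintro ⟨⟨h, h0⟩, h1, h2⟩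
    exact ⟨h2.1, h0, h1.2⟩
  · rintro ⟨h1, h2, h3⟩
    exact ⟨⟨by linarith, h2⟩, ⟨by linarith, h3⟩, h1, by linarith⟩

theorem mem_T₂'_iff {α : ℝ} {x : Fin 2 → ℝ} :
    x ∈ T₂' α ↔ x 1 ≤ x 0 ∧ α ≤ x 1 ∧ x 0 + x 1 ≤ 2 * α + 1 := by
  have h0 : rho 2 1 α 0 = α + 1 := by simp [rho]; ring
  have h1 : rho 2 1 α 1 = α := by simp [rho]; ring
  rw [T₂', Set.mem_ofPred_eq, h0, h1, show α + 1 + α = 2 * α + 1 by ring]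

theorem W_eq_S (m : ℕ) : W m = {x | x ∈ T₂' (((m : ℝ) + 1) / 2) ∧
    0 ≤ S m (x 0 - ((m : ℝ) + 1) / 2) (x 1 - ((m : ℝ) + 1) / 2)} := by
  ext x
  simp only [W, Set.mem_ofPred_eq, mem_T₂'_iff, mem_T₂_iff (by positivity : (0 : ℝ) ≤ ((m : ℝ) + 1) / 2)]
  constructor
  · rintro ⟨⟨h1, h2, h3⟩, h⟩
    have := add_le_one_of_S_nonneg m (by linarith) (by linarith) (by linarith) h
    exact ⟨⟨h2, h1, by linarith⟩, h⟩
  · rintro ⟨⟨h1, h2, h3⟩, h⟩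
    exact ⟨⟨h2, h1, by linarith⟩, h⟩

theorem sqProd_self (a : ℝ) {k : ℕ} (hk : k ≠ 0) : sqProd a a k = 0 := by
  obtain ⟨k, rfl⟩ := Nat.exists_eq_succ_of_ne_zero hk
  rw [sqProd_succ', sub_self, zero_mul]

theorem ratio_zero_right (m : ℕ) (t : ℝ) {c : ℕ} (hc : c ≠ 0) : ratio m t 0 c = 0 := by
  rw [ratio, add_zero, sqProd_self _ hc, zero_div]

theorem tsum_ratio_zero_right (m : ℕ) (t : ℝ) : ∑' c, ratio m t 0 c = 1 := by
  rw [tsum_eq_single 0 fun c hc => ratio_zero_right m t hc]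
  simp [ratio, sqProd_zero]

theorem summable_RTerm (m : ℕ) {x : Fin 2 → ℝ} (hx : x ∈ T₂' (((m : ℝ) + 1) / 2)) :
    Summable (RTerm (((m : ℝ) + 1) / 2) x) := by
  obtain ⟨h1, h2, h3⟩ := mem_T₂'_iff.1 hx
  rw [RTerm_eq_ratio]
  by_cases h : x 0 - ((m : ℝ) + 1) / 2 < 1
  · exact summable_ratio (by linarith) h (by linarith) (by linarith)
  · rw [show x 1 - ((m : ℝ) + 1) / 2 = 0 by linarith]
    exact summable_of_ne_finset_zero (s := {0}) fun c hc =>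
      ratio_zero_right m _ (by simpa using hc)

theorem W_eq_R (m : ℕ) : W m = {x | x ∈ T₂' (((m : ℝ) + 1) / 2) ∧
    0 ≤ R (((m : ℝ) + 1) / 2) x} := by
  rw [W_eq_S]
  ext x
  simp only [Set.mem_ofPred_eq, mem_T₂'_iff, and_congr_right_iff]
  rintro ⟨h1, h2, h3⟩
  rw [R, RTerm_eq_ratio]
  by_cases h : x 0 - ((m : ℝ) + 1) / 2 < 1
  · exact S_nonneg_iff m (by linarith) h (by linarith) (by linarith)
  -- Only the corner remains; there `R = 1` and `S = 0`, so both conditions hold.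
  · rw [show x 1 - ((m : ℝ) + 1) / 2 = 0 by linarith,
      show x 0 - ((m : ℝ) + 1) / 2 = 1 by linarith, tsum_ratio_zero_right]
    simp [S, s]

/-! ### Positivity of the polynomials and the shape of `A₀`. -/

theorem sqProd_mul_prod_Ico_eq {a x : ℝ} (h : ∀ k, sqProd (a + 1) x k ≠ 0) (p : ℝ) {c k : ℕ}
    (hc : c ≤ k) : p * ∏ j ∈ Ico c k, ((a + 1 + j) ^ 2 - x ^ 2) =
      sqProd (a + 1) x k * (p / sqProd (a + 1) x c) := by
  have h1 : sqProd (a + 1) x c * ∏ j ∈ Ico c k, ((a + 1 + j) ^ 2 - x ^ 2) = sqProd (a + 1) x k :=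
    prod_range_mul_prod_Ico _ hc
  have := h c
  rw [← h1]
  field_simp

theorem q_one_row (a : ℝ) {x : Fin 2 → ℝ} (h : ∀ k, sqProd (a + 1) (x 0) k ≠ 0) {l : Fin 2 → ℕ}
    (hl : Antitone l) (hl1 : l 1 = 0) : q 1 a l x = sqProd (a + 1) (x 0) (l 0) *
      ∑ c ∈ range (l 0 + 1), sqProd a (x 1) c / sqProd (a + 1) (x 0) c := by
  rw [q_rank_two _ _ hl, hl1, mul_sum, Nat.range_succ_eq_Icc_zero]
  refine sum_congr rfl fun c hc => ?_
  rw [prod_range_zero, one_mul]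
  exact sqProd_mul_prod_Ico_eq h (sqProd a (x 1) c) (mem_Icc.1 hc).2

/-- The partial sums decrease to the sum of the series. -/
theorem sum_ratio_nonneg_iff (m : ℕ) {t u : ℝ} (ht : 0 ≤ t) (ht1 : t < 1) (hu : 0 ≤ u)
    (hu1 : u ≤ 1) : (∀ k, 0 ≤ ∑ c ∈ range (k + 1), ratio m t u c) ↔ 0 ≤ ∑' c, ratio m t u c := by
  have hs := summable_ratio (m := m) ht ht1 hu hu1
  constructor
  · intro h
    exact ge_of_tendsto' (hs.hasSum.tendsto_sum_nat.comp (tendsto_add_atTop_nat 1)) h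
  · intro h k
    rw [← hs.sum_add_tsum_nat_add (k + 1)] at h
    have : ∑' c, ratio m t u (c + (k + 1)) ≤ 0 := tsum_nonpos fun c =>
      ratio_nonpos ht ht1 hu hu1 (c + k)
    linarith

theorem prod_Ico_nonneg {a x : ℝ} (hx : 0 ≤ x) (h : x ≤ a) (c k : ℕ) :
    0 ≤ ∏ j ∈ Ico c k, ((a + j) ^ 2 - x ^ 2) := by
  refine prod_nonneg fun j _ => ?_
  have : (0 : ℝ) ≤ j := j.cast_nonneg
  nlinarith

/-- On `T₂` every `q_l` with two nonempty rows is nonnegative. -/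
theorem q_nonneg_of_two_rows {α : ℝ} (hα : 0 ≤ α) {x : Fin 2 → ℝ} (h1 : α ≤ x 1) (h2 : x 1 ≤ x 0)
    (h3 : x 0 ≤ α + 1) {l : Fin 2 → ℕ} (hl : Antitone l) (hl1 : l 1 ≠ 0) : 0 ≤ q 1 α l x := by
  have hneg : ∀ y k, α ≤ y → y ≤ α + 1 → k ≠ 0 → sqProd α y k ≤ 0 := by
    intro y k hy hy1 hk
    obtain ⟨k, rfl⟩ := Nat.exists_eq_succ_of_ne_zero hk
    rw [sqProd_succ']
    exact mul_nonpos_of_nonpos_of_nonneg (by nlinarith) (sqProd_nonneg (by linarith) hy1 k)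
  rw [q_rank_two _ _ hl]
  -- Since `c ≥ l 1 ≥ 1`, each summand contains two nonpositive products, one in each variable.
  refine sum_nonneg fun c hc => ?_
  have hc1 := (mem_Icc.1 hc).1
  rw [← mul_assoc]
  refine mul_nonneg (mul_nonneg_of_nonpos_of_nonpos ?_ ?_)
    (prod_Ico_nonneg (by linarith) (by linarith) _ _)
  · exact hneg (x 0) (l 1) (by linarith) h3 hl1
  · exact hneg (x 1) c h1 (by linarith) (by omega)

theorem q_nonneg_of_mem_T₁ {α : ℝ} {x : Fin 2 → ℝ} (hx : x ∈ T₁ α) {l : Fin 2 → ℕ}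
    (hl : Antitone l) : 0 ≤ q 1 α l x := by
  obtain ⟨h1, h2, h3⟩ := mem_T₁_iff.1 hx
  rw [q_rank_two _ _ hl]
  exact sum_nonneg fun c _ => mul_nonneg (sqProd_nonneg (by linarith) h3 _)
    (mul_nonneg (sqProd_nonneg h1 (by linarith) _) (prod_Ico_nonneg (by linarith) (by linarith) _ _))

theorem antitone_two {a b : ℕ} (h : b ≤ a) : Antitone ![a, b] :=
  Fin.antitone_iff_succ_le.2 fun i => by fin_cases i; exact h

theorem q_one_zero (α : ℝ) (x : Fin 2 → ℝ) :
    q 1 α ![1, 0] x = (α + 1) ^ 2 - x 0 ^ 2 + (α ^ 2 - x 1 ^ 2) := by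
  rw [q_rank_two _ _ (antitone_two zero_le_one)]
  have h : Icc 0 1 = ({0, 1} : Finset ℕ) := rfl
  simp [h]

theorem q_one_one (α : ℝ) (x : Fin 2 → ℝ) :
    q 1 α ![1, 1] x = (α ^ 2 - x 0 ^ 2) * (α ^ 2 - x 1 ^ 2) := by
  rw [q_rank_two _ _ (antitone_two le_rfl)]
  simp

theorem mem_A₀_iff_of_lt (m : ℕ) {x : Fin 2 → ℝ} (h1 : ((m : ℝ) + 1) / 2 ≤ x 1) (h2 : x 1 ≤ x 0)
    (h3 : x 0 < ((m : ℝ) + 1) / 2 + 1) : x ∈ A₀ 2 1 (((m : ℝ) + 1) / 2) ↔ x ∈ W m := by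
  have hα : (0 : ℝ) ≤ ((m : ℝ) + 1) / 2 := by positivity
  have ht : 0 ≤ x 0 - ((m : ℝ) + 1) / 2 := by linarith
  have ht1 : x 0 - ((m : ℝ) + 1) / 2 < 1 := by linarith
  have hu : 0 ≤ x 1 - ((m : ℝ) + 1) / 2 := by linarith
  have hu1 : x 1 - ((m : ℝ) + 1) / 2 ≤ 1 := by linarith
  have hpos : ∀ k, 0 < sqProd (((m : ℝ) + 1) / 2 + 1) (x 0) k :=
    fun k => sqProd_pos (by linarith) h3 k
  have hq : ∀ l : Fin 2 → ℕ, Antitone l → l 1 = 0 → (0 ≤ q 1 (((m : ℝ) + 1) / 2) l x ↔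
      0 ≤ ∑ c ∈ range (l 0 + 1), ratio m (x 0 - ((m : ℝ) + 1) / 2) (x 1 - ((m : ℝ) + 1) / 2) c) := by
    intro l hl hl1
    rw [q_one_row _ (fun k => (hpos k).ne') hl hl1, mul_nonneg_iff_of_pos_left (hpos _)]
    simp only [ratio, add_sub_cancel]
  have hx : x ∈ T₂ (((m : ℝ) + 1) / 2) := (mem_T₂_iff hα).2 ⟨h1, h2, h3.le⟩
  rw [W, Set.mem_ofPred_eq, and_iff_right hx, S_nonneg_iff m ht ht1 hu hu1,
    ← sum_ratio_nonneg_iff m ht ht1 hu hu1, A₀, Set.mem_ofPred_eq, and_iff_right hx.1]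
  constructor
  · intro h k
    exact (hq ![k, 0] (antitone_two (Nat.zero_le k)) rfl).1 (h _ (antitone_two (Nat.zero_le k)))
  · intro h l hl
    by_cases hl1 : l 1 = 0
    · exact (hq l hl hl1).2 (h _)
    · exact q_nonneg_of_two_rows hα h1 h2 h3.le hl hl1

/-- At the corner `(ρ_1, ρ_2)` every `q_l` is nonnegative. -/
theorem q_nonneg_of_corner {α : ℝ} (hα : 0 ≤ α) {x : Fin 2 → ℝ} (h1 : x 1 = α)
    (h0 : x 0 = α + 1) {l : Fin 2 → ℕ} (hl : Antitone l) : 0 ≤ q 1 α l x := by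
  by_cases hl1 : l 1 = 0
  · rw [q_rank_two _ _ hl, hl1]
    refine sum_nonneg fun c _ => ?_
    rw [prod_range_zero, one_mul]
    exact mul_nonneg (sqProd_nonneg (by linarith) h1.le c)
      (prod_Ico_nonneg (by linarith) h0.le _ _)
  · exact q_nonneg_of_two_rows hα h1.ge (by linarith) h0.le hl hl1

theorem A₀_eq (m : ℕ) : A₀ 2 1 (((m : ℝ) + 1) / 2) = T₁ (((m : ℝ) + 1) / 2) ∪ W m := by
  have hα : (0 : ℝ) ≤ ((m : ℝ) + 1) / 2 := by positivity
  ext x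
  constructor
  · intro hx
    obtain ⟨h0, h1⟩ := mem_chamber_two_iff.1 hx.1
    rcases le_or_gt (x 0) (((m : ℝ) + 1) / 2) with h | h
    · exact Or.inl (mem_T₁_iff.2 ⟨h0, h1, h⟩)
    right
    have q10 := hx.2 _ (antitone_two zero_le_one)
    have q11 := hx.2 _ (antitone_two (le_refl 1))
    rw [q_one_zero] at q10
    rw [q_one_one] at q11
    -- The shape (1,1) forbids `x 1 < α < x 0`.
    have h2 : ((m : ℝ) + 1) / 2 ≤ x 1 := by
      by_contra! hlt
      have h3 : (((m : ℝ) + 1) / 2) ^ 2 - x 0 ^ 2 < 0 := by nlinarith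
      have h4 : 0 < (((m : ℝ) + 1) / 2) ^ 2 - x 1 ^ 2 := by nlinarith
      exact absurd q11 (not_le.2 (mul_neg_of_neg_of_pos h3 h4))
    rcases lt_or_ge (x 0) (((m : ℝ) + 1) / 2 + 1) with h3 | h3
    · exact (mem_A₀_iff_of_lt m h2 h1 h3).1 hx
    -- With `x 0 ≥ α + 1` and `x 1 ≥ α`, both differences in the shape (1,0) are nonpositive, so
    -- both vanish: the point is the corner.
    · have h4 : x 1 = ((m : ℝ) + 1) / 2 := by
        by_contra hne
        have : ((m : ℝ) + 1) / 2 < x 1 := lt_of_le_of_ne h2 (Ne.symm hne)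
        nlinarith
      have h5 : x 0 = ((m : ℝ) + 1) / 2 + 1 := by
        rw [h4] at q10
        exact le_antisymm (by nlinarith) h3
      refine ⟨(mem_T₂_iff hα).2 ⟨h2, h1, h5.le⟩, ?_⟩
      rw [h4, h5]
      simp [S, s]
  · rintro (hx | hx)
    · exact ⟨hx.1, fun l hl => q_nonneg_of_mem_T₁ hx hl⟩
    · have hx' := hx
      rw [W_eq_S] at hx'
      obtain ⟨h1, h2, h3⟩ := mem_T₂'_iff.1 hx'.1
      rcases lt_or_ge (x 0) (((m : ℝ) + 1) / 2 + 1) with h | h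
      · exact (mem_A₀_iff_of_lt m h2 h1 h).2 hx
      · exact ⟨hx.1.1, fun l hl => q_nonneg_of_corner hα (by linarith) (by linarith) hl⟩

end Okounkov

theorem theorem6 (m : ℕ) :
    Okounkov.A₀ 2 1 (((m : ℝ) + 1) / 2) =
        Okounkov.T₁ (((m : ℝ) + 1) / 2) ∪ Okounkov.W m ∧
      Okounkov.W m =
        {x | x ∈ Okounkov.T₂' (((m : ℝ) + 1) / 2) ∧
          0 ≤ Okounkov.S m (x 0 - ((m : ℝ) + 1) / 2) (x 1 - ((m : ℝ) + 1) / 2)} ∧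
      (∀ x ∈ Okounkov.T₂' (((m : ℝ) + 1) / 2),
        Summable (Okounkov.RTerm (((m : ℝ) + 1) / 2) x)) ∧
      Okounkov.W m =
        {x | x ∈ Okounkov.T₂' (((m : ℝ) + 1) / 2) ∧
          0 ≤ Okounkov.R (((m : ℝ) + 1) / 2) x} := by
  exact ⟨Okounkov.A₀_eq m, Okounkov.W_eq_S m, fun _ => Okounkov.summable_RTerm m, Okounkov.W_eq_R m⟩
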